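/- Let $F\colon \mathbf{Set}\to\mathbf{Set}$ be a finitary functor (i.e. one preserving filtered colimits) with $F\emptyset\neq\emptyset$. Then $F$ has an initial algebra $\iota\colon F(\mu F)\to\mu F$ and a terminal coalgebra $\tau\colon \nu F\to F(\nu F)$; both $\iota$ and $\tau$ are bijections. Let $F^\omega 1=\lim_{n<\omega}F^n1$ be the limit of the sequence $1\leftarrow F1\leftarrow FF1\leftarrow\cdots$ (whose maps are $v_{1,0}=\,!\colon F1\to1$ and $v_{n+2,n+1}=Fv_{n+1,n}$), with the metric in which distinct points $x,y$ have distance $2^{-n}$ for the least $n$ such that the projections of $x$ and $y$ to $F^n1$ differ. Let $c\colon\nu F\to F^\omega1$ be the canonical map, with components $c_0=\,!$ and $c_{n+1}=Fc_n\cdot\tau$, and let $m\colon\mu F\to\nu F$ be the unique coalgebra homomorphism from $(\mu F,\iota^{-1})$ to $(\nu F,\tau)$. Then: 1. $c$ and $m$ are injective, so that $\nu F$ becomes a metric subspace of $F^\omega 1$ via $c$, and $\mu F$ a metric subspace of $\nu F$ via $m$; all these metrics are ultrametrics. 2. The Cauchy completions of $\mu F$ and $\nu F$ coincide, namely with $F^\omega1$: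 the space $F^\omega 1$ is complete, and the isometric embeddings $c$ and $c\cdot m$ have dense images. 3. Let $F(\nu F)$ and $F(\mu F)$ carry the metrics transported from $\nu F$ and $\mu F$ along $\tau$ and $\iota$. Then $Fm\colon F(\mu F)\to F(\nu F)$ is an isometric embedding, $\iota^{-1}$ is continuous, and $\tau$ is the unique continuous extension of $\iota^{-1}$, i.e. the unique continuous map $g\colon\nu F\to F(\nu F)$ with $g\cdot m=Fm\cdot\iota^{-1}$. -/

import Mathlib

open CategoryTheory CategoryTheory.Limits CategoryTheory.Endofunctor

universe u

namespace SetFunctor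

/-- The objects `Fⁿ 1` (`n < ω`) of the terminal-coalgebra chain. -/
def chainObj (F : Type u ⥤ Type u) : ℕ → Type u
  | 0 => PUnit.{u + 1}
  | n + 1 => F.obj (chainObj F n)

/-- The connecting maps `v_{n+1,n} : Fⁿ⁺¹ 1 ⟶ Fⁿ 1`, with `v_{1,0}` the unique map to `1` and
`v_{n+2,n+1} = F v_{n+1,n}`. -/
def chainMap (F : Type u ⥤ Type u) : ∀ n, chainObj F (n + 1) ⟶ chainObj F n
  | 0 => ↾(fun _ => PUnit.unit)
  | n + 1 => F.map (chainMap F n)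

/-- `F^ω 1`, the limit of the sequence `1 ← F 1 ← F (F 1) ← ⋯`, as the set of compatible
sequences. -/
def OmegaLimit (F : Type u ⥤ Type u) : Type u :=
  {x : ∀ n, chainObj F n // ∀ n, chainMap F n (x (n + 1)) = x n}

/-- The ultrametric of `F^ω 1`: two distinct points have distance `(1/2)ⁿ`, where `n` is the first
index such that the projection to `Fⁿ 1` separates them. -/
noncomputable instance (F : Type u ⥤ Type u) : MetricSpace (OmegaLimit F) where
  dist x y := PiNat.dist.dist x.1 y.1
  dist_self x := PiNat.dist_self x.1
  dist_comm x y := PiNat.dist_comm x.1 y.1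
  dist_triangle x y z := PiNat.dist_triangle x.1 y.1 z.1
  eq_of_dist_eq_zero {x y} h := Subtype.ext (PiNat.eq_of_dist_eq_zero x.1 y.1 h)

/-- The canonical cone of a coalgebra `(V, τ)` over the sequence `Fⁿ 1`: the map `V ⟶ 1`, followed
recursively by `V ⟶ F V ⟶ F (Fⁿ 1)`. -/
def cone {F : Type u ⥤ Type u} (V : Coalgebra F) : ∀ n, V.V ⟶ chainObj F n
  | 0 => ↾(fun _ => PUnit.unit)
  | n + 1 => V.str ≫ F.map (cone V n)

theorem cone_comp {F : Type u ⥤ Type u} (V : Coalgebra F) (n : ℕ) :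
    cone V (n + 1) ≫ chainMap F n = cone V n := by
  induction n with
  | zero => rfl
  | succ n ih =>
    change (V.str ≫ F.map (cone V (n + 1))) ≫ F.map (chainMap F n) = V.str ≫ F.map (cone V n)
    rw [Category.assoc, ← F.map_comp, ih]

/-- The canonical map of a coalgebra into `F^ω 1`. -/
def toOmega {F : Type u ⥤ Type u} (V : Coalgebra F) (x : V.V) : OmegaLimit F :=
  ⟨fun n => cone V n x, fun n => ConcreteCategory.congr_hom (cone_comp V n) x⟩

/-- The inverse `ι⁻¹` of the structure map of an initial algebra, as a coalgebra on `μF`. -/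
def invCoalgebra {F : Type u ⥤ Type u} {A : Algebra F} (hA : IsInitial A) : Coalgebra F :=
  ⟨A.a, Algebra.Initial.strInv hA⟩

/-- The canonical map `m : μF ⟶ νF`: the unique coalgebra homomorphism from `(μF, ι⁻¹)` to the
terminal coalgebra. -/
def inclusion {F : Type u ⥤ Type u} {A : Algebra F} (hA : IsInitial A)
    {N : Coalgebra F} (hN : IsTerminal N) : A.a ⟶ N.V :=
  (hN.from (invCoalgebra hA)).f

theorem initial_str_injective {F : Type u ⥤ Type u} {A : Algebra F} (hA : IsInitial A) :
    Function.Injective A.str :=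
  Function.LeftInverse.injective (g := Algebra.Initial.strInv hA) fun x =>
    ConcreteCategory.congr_hom (Algebra.Initial.right_inv hA) x

theorem terminal_strInv_injective {F : Type u ⥤ Type u} {N : Coalgebra F} (hN : IsTerminal N) :
    Function.Injective (Coalgebra.Terminal.strInv hN) :=
  Function.LeftInverse.injective (g := N.str) fun x =>
    ConcreteCategory.congr_hom (Coalgebra.Terminal.left_inv hN) x

/-- `νF` as a metric subspace of `F^ω 1`, for a terminal coalgebra that embeds into it. -/
noncomputable abbrev nuMetric {F : Type u ⥤ Type u} {N : Coalgebra F}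
    (h : Function.Injective (toOmega N)) : MetricSpace N.V :=
  MetricSpace.induced (toOmega N) h inferInstance

/-- `μF` as a metric subspace of `νF` via `m`. -/
noncomputable abbrev muMetric {F : Type u ⥤ Type u} {A : Algebra F} (hA : IsInitial A)
    {N : Coalgebra F} (hN : IsTerminal N) (h : Function.Injective (toOmega N))
    (hm : Function.Injective (inclusion hA hN)) : MetricSpace A.a :=
  MetricSpace.induced (inclusion hA hN) hm (nuMetric h)

/-- The metric of `F(νF)`, transported from `νF` along the bijection `τ`. -/
noncomputable abbrev mapNuMetric {F : Type u ⥤ Type u}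
    {N : Coalgebra F} (hN : IsTerminal N) (h : Function.Injective (toOmega N)) :
    MetricSpace (F.obj N.V) :=
  MetricSpace.induced (Coalgebra.Terminal.strInv hN) (terminal_strInv_injective hN) (nuMetric h)

/-- The metric of `F(μF)`, transported from `μF` along the bijection `ι`. -/
noncomputable abbrev mapMuMetric {F : Type u ⥤ Type u} {A : Algebra F} (hA : IsInitial A)
    {N : Coalgebra F} (hN : IsTerminal N) (h : Function.Injective (toOmega N))
    (hm : Function.Injective (inclusion hA hN)) : MetricSpace (F.obj A.a) :=
  MetricSpace.induced A.str (initial_str_injective hA) (muMetric hA hN h hm)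

/-- `i : X → Y` exhibits the metric space `Y` as the Cauchy completion of `X`. -/
structure IsCauchyCompletion {X Y : Type*} [MetricSpace X] [MetricSpace Y] (i : X → Y) :
    Prop where
  complete : CompleteSpace Y
  isometry : Isometry i
  dense : DenseRange i

end SetFunctor

/-! Finitarity is used in one way: an element of `F X` lives on a finite subset of `X`, so a
property that holds eventually in `n` at each point of `X` holds at a single stage for all points
involved. The terminal coalgebra is the set of points of `F^ω 1` realized by a state of some
coalgebra. Its structure is determined by the projections, since these stay jointly injective after
applying `F` (`map_jointly_injective`); hence `c` is injective. A point `p` of `F ∅` gives maps `Fⁿ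
1 ⟶ A` into every algebra. Composed with the cone of a coalgebra they approximate a map to `A`, and
the states where the approximations stabilize are closed under the inverse structure
(`eventually_approx_cone_eq`). So the least subalgebra of `νF` is initial, and on `μF` the
approximations of `x` stabilize at `x`, which makes `c · m` injective. Finally `Fⁿ 1 ⟶ μF ⟶ Fⁿ 1` is
the identity, so `μF` is dense in `F^ω 1`. -/

namespace SetFunctor

open Filter Topology

/-! ### Finitary functors and finite subsets. -/

section Finitary

/-- The finite subsets of `X`, as a diagram of sets. -/
def finsetDiagram (X : Type u) : Finset X ⥤ Type u where
  obj A := {x // x ∈ A}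
  map f := ↾(fun x => ⟨x.1, leOfHom f x.2⟩)

/-- The cocone exhibiting `X` as the union of its finite subsets. -/
def finsetCocone (X : Type u) : Cocone (finsetDiagram X) where
  pt := X
  ι := { app := fun _ => ↾Subtype.val }

/-- A set is the colimit of its finite subsets. -/
noncomputable def finsetCoconeIsColimit (X : Type u) : IsColimit (finsetCocone X) := by
  classical
  refine Types.FilteredColimit.isColimitOf' (finsetDiagram X) (finsetCocone X) (fun x => ?_)
    (fun A x y h => ?_)
  · exact ⟨({x} : Finset X), ⟨x, Finset.mem_singleton_self x⟩, rfl⟩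
  · exact ⟨A, 𝟙 A, congrArg _ (Subtype.ext h)⟩

variable (F : Type u ⥤ Type u)

/-- An injection with nonempty domain has a retraction, which `F` preserves. -/
theorem map_injective_of_nonempty {X Y : Type u} [Nonempty X] (f : X ⟶ Y)
    (hf : Function.Injective f) : Function.Injective (F.map f) := by
  have h : f ≫ ↾(Function.invFun f) = 𝟙 X := by
    ext x
    exact Function.leftInverse_invFun hf x
  have h' : F.map f ≫ F.map (↾(Function.invFun f)) = 𝟙 (F.obj X) := by
    rw [← F.map_comp, h, F.map_id]
  exact Function.LeftInverse.injective fun x => ConcreteCategory.congr_hom h' x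

variable [PreservesFilteredColimits F]

theorem exists_finset_map_eq₂ {X : Type u} (s t : F.obj X) :
    ∃ (A : Finset X) (s' t' : F.obj {x // x ∈ A}),
      F.map (↾Subtype.val) s' = s ∧ F.map (↾Subtype.val) t' = t := by
  classical
  exact Types.FilteredColimit.jointly_surjective_of_isColimit₂
    (isColimitOfPreserves F (finsetCoconeIsColimit X)) s t

theorem exists_finset_map_eq {X : Type u} (t : F.obj X) :
    ∃ (A : Finset X) (t' : F.obj {x // x ∈ A}), F.map (↾Subtype.val) t' = t :=
  let ⟨A, s, _, h, _⟩ := exists_finset_map_eq₂ F t t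
  ⟨A, s, h⟩

/-- `F` may fail to preserve injections out of `∅`, so the finite support is enlarged by a point of
`X`. -/
theorem exists_nonempty_finset_map_eq₂ {X : Type u} [Nonempty X] (s t : F.obj X) :
    ∃ (A : Finset X) (_ : A.Nonempty) (s' t' : F.obj {x // x ∈ A}),
      F.map (↾Subtype.val) s' = s ∧ F.map (↾Subtype.val) t' = t := by
  classical
  obtain ⟨A, s, t, rfl, rfl⟩ := exists_finset_map_eq₂ F s t
  obtain ⟨x⟩ := ‹Nonempty X›
  let j : {x // x ∈ A} ⟶ {y // y ∈ insert x A} := ↾(fun y => ⟨y.1, Finset.mem_insert_of_mem y.2⟩)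
  exact ⟨insert x A, Finset.insert_nonempty x A, F.map j s, F.map j t,
    (Functor.map_comp_apply F j (↾Subtype.val) s).symm,
    (Functor.map_comp_apply F j (↾Subtype.val) t).symm⟩

/-- A finitary functor preserves the joint injectivity of a sequence of maps that separate more
and more points. -/
theorem map_jointly_injective {X : Type u} [Nonempty X] {Y : ℕ → Type u} (f : ∀ n, X ⟶ Y n)
    (hmono : ∀ x y m n, m ≤ n → f n x = f n y → f m x = f m y)
    (hinj : ∀ x y, (∀ n, f n x = f n y) → x = y)
    (s t : F.obj X) (h : ∀ n, F.map (f n) s = F.map (f n) t) : s = t := by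
  obtain ⟨A, hA, s, t, rfl, rfl⟩ := exists_nonempty_finset_map_eq₂ F s t
  have : Nonempty {x // x ∈ A} := hA.to_subtype
  have hsep : ∀ x y : X, ∀ᶠ n in atTop, f n x = f n y → x = y := by
    intro x y
    by_cases hxy : x = y
    · exact Eventually.of_forall fun _ _ => hxy
    · obtain ⟨m, hm⟩ := not_forall.1 (mt (hinj x y) hxy)
      filter_upwards [eventually_ge_atTop m] with n hn hxy'
      exact (hm (hmono x y m n hn hxy')).elim
  -- `A` has finitely many pairs, so one `n` separates all of them.
  obtain ⟨n, hn⟩ := ((eventually_all_finset A).2 fun x _ =>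
    (eventually_all_finset A).2 fun y _ => hsep x y).exists
  have hval : Function.Injective ((↾Subtype.val : {x // x ∈ A} ⟶ X) ≫ f n) :=
    fun x y hxy => Subtype.ext (hn x.1 x.2 y.1 y.2 hxy)
  rw [map_injective_of_nonempty F _ hval
    ((Functor.map_comp_apply F _ _ _).trans ((h n).trans (Functor.map_comp_apply F _ _ _).symm))]

end Finitary

/-! ### Compatibility of projections and naturality of cones. -/

section Cone

variable {F : Type u ⥤ Type u}

theorem OmegaLimit.apply_eq_of_le {x y : OmegaLimit F} {m n : ℕ} (hmn : m ≤ n)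
    (h : x.1 n = y.1 n) : x.1 m = y.1 m := by
  induction n, hmn using Nat.le_induction with
  | base => exact h
  | succ n _ ih => exact ih (by rw [← x.2, ← y.2, h])

theorem cone_comp_hom {C D : Coalgebra F} (f : C ⟶ D) (n : ℕ) : f.f ≫ cone D n = cone C n := by
  induction n with
  | zero => rfl
  | succ n ih =>
    change f.f ≫ D.str ≫ F.map (cone D n) = C.str ≫ F.map (cone C n)
    rw [← ih, F.map_comp, Coalgebra.Hom.h_assoc]

theorem toOmega_hom {C D : Coalgebra F} (f : C ⟶ D) (x : C.V) :
    toOmega D (f.f x) = toOmega C x :=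
  Subtype.ext (funext fun n => ConcreteCategory.congr_hom (cone_comp_hom f n) x)

end Cone

/-! ### The terminal coalgebra as the set of behaviours. -/

section Terminal

variable (F : Type u ⥤ Type u)

/-- The points of `F^ω 1` that are behaviours of states of some coalgebra. -/
def Behaviour : Type u :=
  {z : OmegaLimit F // ∃ (C : Coalgebra F) (x : C.V), toOmega C x = z}

variable {F}

/-- The projections of `Behaviour F` to the sets `Fⁿ 1`. -/
def Behaviour.proj (n : ℕ) : Behaviour F ⟶ chainObj F n := ↾(fun z => z.1.1 n)

/-- The map sending a state of a coalgebra to its behaviour. -/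
def Behaviour.of (C : Coalgebra F) : C.V ⟶ Behaviour F := ↾(fun x => ⟨toOmega C x, C, x, rfl⟩)

theorem Behaviour.of_comp_proj (C : Coalgebra F) (n : ℕ) :
    Behaviour.of C ≫ Behaviour.proj n = cone C n := rfl

theorem Behaviour.ext {y z : Behaviour F} (h : ∀ n, Behaviour.proj n y = Behaviour.proj n z) :
    y = z :=
  Subtype.ext (Subtype.ext (funext h))

/-- Any realization of `z` by a state supplies a successor structure. When `F` is finitary the
result does not depend on the realization, by `Behaviour.map_proj_jointly_injective`. -/
theorem Behaviour.exists_str (z : Behaviour F) :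
    ∃ t : F.obj (Behaviour F), ∀ n, F.map (Behaviour.proj n) t = Behaviour.proj (n + 1) z := by
  obtain ⟨_, C, x, rfl⟩ := z
  refine ⟨F.map (Behaviour.of C) (C.str x), fun n => ?_⟩
  rw [← Functor.map_comp_apply, Behaviour.of_comp_proj]
  rfl

variable (F) in
/-- The coalgebra of all behaviours. -/
noncomputable def behaviourCoalgebra : Coalgebra F where
  V := Behaviour F
  str := ↾(fun z => (Behaviour.exists_str z).choose)

theorem behaviourCoalgebra_str_comp (n : ℕ) :
    (behaviourCoalgebra F).str ≫ F.map (Behaviour.proj n) = Behaviour.proj (n + 1) := by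
  ext z
  exact (Behaviour.exists_str z).choose_spec n

theorem cone_behaviourCoalgebra (n : ℕ) :
    cone (behaviourCoalgebra F) n = Behaviour.proj n := by
  induction n with
  | zero => rfl
  | succ n ih =>
    rw [← behaviourCoalgebra_str_comp, ← ih]
    rfl

theorem toOmega_behaviourCoalgebra_injective :
    Function.Injective (toOmega (behaviourCoalgebra F)) := by
  intro x y h
  refine Behaviour.ext fun n => ?_
  rw [← cone_behaviourCoalgebra]
  exact congrFun (congrArg Subtype.val h) n

variable [PreservesFilteredColimits F]

theorem Behaviour.map_proj_jointly_injective [Nonempty (Behaviour F)] (s t : F.obj (Behaviour F))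
    (h : ∀ n, F.map (Behaviour.proj n) s = F.map (Behaviour.proj n) t) : s = t :=
  map_jointly_injective F Behaviour.proj
    (fun _ _ _ _ hmn => OmegaLimit.apply_eq_of_le hmn) (fun _ _ => Behaviour.ext) s t h

/-- The unique homomorphism from a coalgebra to the coalgebra of behaviours. -/
def behaviourHom (C : Coalgebra F) : C ⟶ behaviourCoalgebra F where
  f := Behaviour.of C
  h := by
    ext x
    have : Nonempty (Behaviour F) := ⟨Behaviour.of C x⟩
    refine Behaviour.map_proj_jointly_injective _ _ fun n => ?_
    refine (Functor.map_comp_apply F _ _ _).symm.trans ?_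
    rw [Behaviour.of_comp_proj]
    exact (ConcreteCategory.congr_hom (behaviourCoalgebra_str_comp n) (Behaviour.of C x)).symm

variable (F) in
/-- The coalgebra of behaviours is terminal. -/
noncomputable def behaviourCoalgebraIsTerminal : IsTerminal (behaviourCoalgebra F) :=
  IsTerminal.ofUniqueHom behaviourHom fun C f => by
    apply Coalgebra.ext
    ext x
    exact toOmega_behaviourCoalgebra_injective
      ((toOmega_hom f x).trans (toOmega_hom (behaviourHom C) x).symm)

theorem toOmega_injective_of_isTerminal {N : Coalgebra F} (hN : IsTerminal N) :
    Function.Injective (toOmega N) := by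
  intro x y h
  let e := hN.uniqueUpToIso (behaviourCoalgebraIsTerminal F)
  have he : e.hom.f ≫ e.inv.f = 𝟙 N.V := congrArg Coalgebra.Hom.f e.hom_inv_id
  have hxy : e.hom.f x = e.hom.f y := toOmega_behaviourCoalgebra_injective <| by
    rw [toOmega_hom, toOmega_hom, h]
  exact (ConcreteCategory.congr_hom he x).symm.trans
    ((congrArg e.inv.f hxy).trans (ConcreteCategory.congr_hom he y))

end Terminal

/-! ### Approximating maps into an algebra through the chain. -/

section Approximation

variable {F : Type u ⥤ Type u} (p : F.obj PEmpty.{u + 1})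

/-- The maps `Fⁿ 1 ⟶ A` into an algebra induced by a point of `F ∅`. -/
def approx (A : Algebra F) : ∀ n, chainObj F n ⟶ A.a
  | 0 => ↾(fun _ => A.str (F.map (↾PEmpty.elim) p))
  | n + 1 => F.map (approx A n) ≫ A.str

/-- If the approximations of the states `i b` stabilize at `h b`, then those of a state with
successor structure `F i t` stabilize at the value of `F h t`. -/
theorem eventually_approx_cone_eq [PreservesFilteredColimits F] (A : Algebra F) (C : Coalgebra F)
    {B : Type u} (i : B ⟶ C.V) (h : B ⟶ A.a)
    (hi : ∀ b, ∀ᶠ n in atTop, approx p A n (cone C n (i b)) = h b)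
    {t : F.obj B} {v : C.V} (hv : C.str v = F.map i t) :
    ∀ᶠ n in atTop, approx p A n (cone C n v) = A.str (F.map h t) := by
  obtain ⟨D, t, rfl⟩ := exists_finset_map_eq F t
  obtain ⟨N, hN⟩ := eventually_atTop.1 ((eventually_all_finset D).2 fun b _ => hi b)
  -- Stage `n + 1` at `v` is `F` applied to stage `n` on the successors of `v`, hence the shift by
  -- one.
  refine eventually_atTop.2 ⟨N + 1, fun k hk => ?_⟩
  obtain ⟨n, rfl⟩ : ∃ n, k = n + 1 := ⟨k - 1, by omega⟩
  have hcomp : (↾Subtype.val : {b // b ∈ D} ⟶ B) ≫ i ≫ cone C n ≫ approx p A n =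
      ↾Subtype.val ≫ h := by
    ext b
    exact hN n (by omega) b.1 b.2
  change A.str (F.map (approx p A n) (F.map (cone C n) (C.str v))) = _
  rw [hv]
  simp only [← Functor.map_comp_apply, Category.assoc]
  rw [hcomp]

end Approximation

/-! ### The initial algebra as the least subalgebra of `νF`. -/

section Initial

variable {F : Type u ⥤ Type u}

/-- A subset of an algebra that is closed under the algebra structure. -/
def IsSubalgebra (A : Algebra F) (P : Set A.a) : Prop :=
  ∀ t : F.obj P, A.str (F.map (↾Subtype.val) t) ∈ P

/-- A subalgebra, as an algebra. -/
def IsSubalgebra.algebra {A : Algebra F} {P : Set A.a} (hP : IsSubalgebra A P) : Algebra F where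
  a := P
  str := ↾(fun t => ⟨_, hP t⟩)

/-- The inclusion of a subalgebra. -/
def IsSubalgebra.incl {A : Algebra F} {P : Set A.a} (hP : IsSubalgebra A P) : hP.algebra ⟶ A where
  f := ↾Subtype.val
  h := rfl

/-- An initial algebra has no proper subalgebras. -/
theorem IsSubalgebra.mem_of_isInitial {A : Algebra F} {P : Set A.a} (hP : IsSubalgebra A P)
    (hA : IsInitial A) (x : A.a) : x ∈ P := by
  have h : (hA.to hP.algebra).f ≫ hP.incl.f = 𝟙 A.a :=
    congrArg Algebra.Hom.f (hA.hom_ext (hA.to hP.algebra ≫ hP.incl) (𝟙 A))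
  have hx : hP.incl.f ((hA.to hP.algebra).f x) = x := types_congr_hom h x
  rw [← hx]
  exact Subtype.prop (p := (· ∈ P)) _

/-- The carrier of the least subalgebra. -/
def leastSubalgebra (A : Algebra F) : Set A.a :=
  {x | ∀ P, IsSubalgebra A P → x ∈ P}

theorem isSubalgebra_leastSubalgebra (A : Algebra F) : IsSubalgebra A (leastSubalgebra A) := by
  intro t P hP
  let j : (leastSubalgebra A : Type u) ⟶ (P : Type u) := ↾(fun x => ⟨x.1, x.2 P hP⟩)
  have h : F.map (↾Subtype.val) (F.map j t) = F.map (↾Subtype.val) t :=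
    (Functor.map_comp_apply F j (↾Subtype.val) t).symm
  rw [← h]
  exact hP _

/-- The equalizer of the two homomorphisms is itself a subalgebra of `A`. -/
theorem leastSubalgebra_hom_ext {A B : Algebra F}
    (f g : (isSubalgebra_leastSubalgebra A).algebra ⟶ B) : f = g := by
  apply Algebra.ext
  ext x
  have hP : IsSubalgebra A {x | ∃ hx : x ∈ leastSubalgebra A, f.f ⟨x, hx⟩ = g.f ⟨x, hx⟩} := by
    intro t
    let j : ({x // ∃ hx : x ∈ leastSubalgebra A, f.f ⟨x, hx⟩ = g.f ⟨x, hx⟩} : Type u) ⟶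
      (isSubalgebra_leastSubalgebra A).algebra.a := ↾(fun x => ⟨x.1, x.2.choose⟩)
    have hj : F.map (↾Subtype.val) (F.map j t) = F.map (↾Subtype.val) t :=
      (Functor.map_comp_apply F j (↾Subtype.val) t).symm
    have hfg : j ≫ f.f = j ≫ g.f := by
      ext x
      exact x.2.choose_spec
    have hstr : F.map j ≫ (isSubalgebra_leastSubalgebra A).algebra.str ≫ f.f =
        F.map j ≫ (isSubalgebra_leastSubalgebra A).algebra.str ≫ g.f := by
      rw [← f.h, ← g.h, ← F.map_comp_assoc, hfg, F.map_comp_assoc]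
    rw [← hj]
    exact ⟨_, ConcreteCategory.congr_hom hstr t⟩
  exact (x.2 _ hP).choose_spec

/-- The inverse of the structure map of a terminal coalgebra, as an algebra. -/
def invAlgebra {N : Coalgebra F} (hN : IsTerminal N) : Algebra F :=
  ⟨N.V, Coalgebra.Terminal.strInv hN⟩

theorem str_invAlgebra_str {N : Coalgebra F} (hN : IsTerminal N) (t : F.obj N.V) :
    N.str ((invAlgebra hN).str t) = t :=
  ConcreteCategory.congr_hom (Coalgebra.Terminal.left_inv hN) t

variable [PreservesFilteredColimits F]

/-- The homomorphism sends `v` to the eventual value of its approximations; these stabilize on a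
subalgebra, hence on the least one. -/
theorem nonempty_leastSubalgebra_hom (p : F.obj PEmpty.{u + 1}) {N : Coalgebra F}
    (hN : IsTerminal N) (A : Algebra F) :
    Nonempty ((isSubalgebra_leastSubalgebra (invAlgebra hN)).algebra ⟶ A) := by
  have hP : IsSubalgebra (invAlgebra hN)
      {v : N.V | ∃ a, ∀ᶠ n in atTop, approx p A n (cone N n v) = a} := by
    intro t
    exact ⟨_, eventually_approx_cone_eq p A N (↾Subtype.val) (↾(fun v => v.2.choose))
      (fun v => v.2.choose_spec) (str_invAlgebra_str hN _)⟩
  choose h hh using fun v : leastSubalgebra (invAlgebra hN) => v.2 _ hP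
  refine ⟨⟨↾h, ?_⟩⟩
  ext t
  obtain ⟨n, h₁, h₂⟩ := ((hh ⟨_, isSubalgebra_leastSubalgebra (invAlgebra hN) t⟩).and
    (eventually_approx_cone_eq p A N (↾Subtype.val) (↾h) hh (str_invAlgebra_str hN _))).exists
  exact h₂.symm.trans h₁

theorem hasInitial_algebra (p : F.obj PEmpty.{u + 1}) {N : Coalgebra F} (hN : IsTerminal N) :
    HasInitial (Algebra F) :=
  (IsInitial.ofUniqueHom (fun A => (nonempty_leastSubalgebra_hom p hN A).some)
    fun _ _ => leastSubalgebra_hom_ext _ _).hasInitial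

end Initial

/-! ### The map from `μF` to `F^ω 1`. -/

section Inclusion

variable {F : Type u ⥤ Type u} {A : Algebra F} (hA : IsInitial A) {N : Coalgebra F}
  (hN : IsTerminal N)

theorem strInv_str (t : F.obj A.a) : Algebra.Initial.strInv hA (A.str t) = t :=
  ConcreteCategory.congr_hom (Algebra.Initial.right_inv hA) t

theorem str_inclusion (x : A.a) :
    N.str (inclusion hA hN x) = F.map (inclusion hA hN) (Algebra.Initial.strInv hA x) :=
  (ConcreteCategory.congr_hom (hN.from (invCoalgebra hA)).h x).symm

theorem toOmega_inclusion (x : A.a) :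
    toOmega N (inclusion hA hN x) = toOmega (invCoalgebra hA) x :=
  toOmega_hom (hN.from (invCoalgebra hA)) x

theorem strInv_map_inclusion (t : F.obj A.a) :
    Coalgebra.Terminal.strInv hN (F.map (inclusion hA hN) t) = inclusion hA hN (A.str t) := by
  have h := str_inclusion hA hN (A.str t)
  rw [strInv_str] at h
  rw [← h]
  exact ConcreteCategory.congr_hom (Coalgebra.Terminal.right_inv hN) _

/-- This makes each `Fⁿ 1` a retract of `μF`, the source of density. -/
theorem approx_comp_cone (p : F.obj PEmpty.{u + 1}) (n : ℕ) :
    approx p A n ≫ cone (invCoalgebra hA) n = 𝟙 (chainObj F n) := by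
  induction n with
  | zero => rfl
  | succ n ih =>
    change (F.map (approx p A n) ≫ A.str) ≫ Algebra.Initial.strInv hA ≫
      F.map (cone (invCoalgebra hA) n) = 𝟙 (F.obj (chainObj F n))
    rw [Category.assoc, ← Category.assoc A.str, Algebra.Initial.right_inv, Category.id_comp]
    exact (F.map_comp _ _).symm.trans ((congrArg F.map ih).trans (F.map_id _))

theorem exists_toOmega_apply_eq (p : F.obj PEmpty.{u + 1}) (z : OmegaLimit F) (n : ℕ) :
    ∃ x : A.a, (toOmega (invCoalgebra hA) x).1 n = z.1 n :=
  ⟨approx p A n (z.1 n), ConcreteCategory.congr_hom (approx_comp_cone hA p n) (z.1 n)⟩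

/-- By minimality of `μF`, every `x` is recovered from its projection to some `Fⁿ 1`. -/
theorem toOmega_invCoalgebra_injective [PreservesFilteredColimits F]
    (p : F.obj PEmpty.{u + 1}) :
    Function.Injective (toOmega (invCoalgebra hA)) := by
  have hP : IsSubalgebra A
      {x | ∀ᶠ n in atTop, approx p A n (cone (invCoalgebra hA) n x) = x} := by
    intro t
    exact eventually_approx_cone_eq p A (invCoalgebra hA) (↾Subtype.val) (↾Subtype.val)
      (fun x => x.2) (strInv_str hA _)
  intro x y h
  obtain ⟨n, hx, hy⟩ :=
    (Eventually.and (hP.mem_of_isInitial hA x) (hP.mem_of_isInitial hA y)).exists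
  have hn : cone (invCoalgebra hA) n x = cone (invCoalgebra hA) n y :=
    congrFun (congrArg Subtype.val h) n
  rw [← hx, hn, hy]

end Inclusion

/-! ### Completeness of `F^ω 1` and density of `μF`. -/

section Metric

variable {F : Type u ⥤ Type u}

theorem OmegaLimit.apply_eq_of_dist_lt {x y : OmegaLimit F} {n : ℕ}
    (h : dist x y < (1 / 2) ^ n) : x.1 n = y.1 n :=
  PiNat.apply_eq_of_dist_lt h le_rfl

theorem OmegaLimit.dist_le_of_apply_eq {x y : OmegaLimit F} {n : ℕ} (h : x.1 n = y.1 n) :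
    dist x y ≤ (1 / 2) ^ n :=
  PiNat.mem_cylinder_iff_dist_le.1 fun _ hi => OmegaLimit.apply_eq_of_le hi.le h

instance : IsUltrametricDist (OmegaLimit F) :=
  ⟨fun x y z => PiNat.dist_triangle_nonarch x.1 y.1 z.1⟩

theorem OmegaLimit.exists_pow_lt {ε : ℝ} (hε : 0 < ε) : ∃ n : ℕ, (1 / 2 : ℝ) ^ n < ε :=
  exists_pow_lt_of_lt_one hε (by norm_num)

instance : CompleteSpace (OmegaLimit F) := by
  refine Metric.complete_of_cauchySeq_tendsto fun u hu => ?_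
  have hN : ∀ n : ℕ, ∃ N, ∀ k ≥ N, (u k).1 n = (u N).1 n := fun n =>
    let ⟨N, hN⟩ := Metric.cauchySeq_iff'.1 hu ((1 / 2) ^ n) (by positivity)
    ⟨N, fun k hk => OmegaLimit.apply_eq_of_dist_lt (hN k hk)⟩
  choose N hN using hN
  have hx : ∀ n, chainMap F n ((u (N (n + 1))).1 (n + 1)) = (u (N n)).1 n := by
    intro n
    -- Both coordinates are read off from the same term of the sequence, at an index beyond `N n`
    -- and `N (n + 1)`.
    rw [← hN (n + 1) _ (le_max_left _ (N n)), (u _).2, hN n _ (le_max_right _ _)]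
  refine ⟨⟨fun n => (u (N n)).1 n, hx⟩, Metric.tendsto_atTop.2 fun ε hε => ?_⟩
  obtain ⟨n, hn⟩ := OmegaLimit.exists_pow_lt hε
  exact ⟨N n, fun k hk =>
    (OmegaLimit.dist_le_of_apply_eq (y := ⟨fun n => (u (N n)).1 n, hx⟩) (hN n k hk)).trans_lt hn⟩

theorem denseRange_toOmega_invCoalgebra (p : F.obj PEmpty.{u + 1}) {A : Algebra F}
    (hA : IsInitial A) : DenseRange (toOmega (invCoalgebra hA)) := by
  intro z
  refine Metric.mem_closure_range_iff.2 fun ε hε => ?_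
  obtain ⟨n, hn⟩ := OmegaLimit.exists_pow_lt hε
  obtain ⟨x, hx⟩ := exists_toOmega_apply_eq hA p z n
  exact ⟨x, (OmegaLimit.dist_le_of_apply_eq hx.symm).trans_lt hn⟩

end Metric

end SetFunctor

/-! ### Assembly of the main theorem. -/

open SetFunctor in
theorem theoremT (F : Type u ⥤ Type u) [PreservesFilteredColimits F]
    (hF : Nonempty (F.obj PEmpty.{u + 1})) :
    HasInitial (Algebra F) ∧ HasTerminal (Coalgebra F) ∧
    ∀ (A : Algebra F) (hA : IsInitial A) (N : Coalgebra F) (hN : IsTerminal N),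
      ∃ (hν : Function.Injective (SetFunctor.toOmega N))
        (hμ : Function.Injective (SetFunctor.inclusion hA hN)),
        letI : MetricSpace N.V := SetFunctor.nuMetric hν
        letI : MetricSpace A.a := SetFunctor.muMetric hA hN hν hμ
        letI : MetricSpace (F.obj N.V) := SetFunctor.mapNuMetric hN hν
        letI : MetricSpace (F.obj A.a) := SetFunctor.mapMuMetric hA hN hν hμ
        IsUltrametricDist (SetFunctor.OmegaLimit F) ∧
        IsUltrametricDist N.V ∧ IsUltrametricDist A.a ∧
        SetFunctor.IsCauchyCompletion (SetFunctor.toOmega N) ∧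
        SetFunctor.IsCauchyCompletion
          (fun x : A.a => SetFunctor.toOmega N (SetFunctor.inclusion hA hN x)) ∧
        Isometry (F.map (SetFunctor.inclusion hA hN)) ∧
        Continuous (Algebra.Initial.strInv hA) ∧
        Continuous N.str ∧
        (∀ x : A.a, N.str (SetFunctor.inclusion hA hN x) =
          F.map (SetFunctor.inclusion hA hN) (Algebra.Initial.strInv hA x)) ∧
        ∀ g : N.V → F.obj N.V, Continuous g →
          (∀ x : A.a, g (SetFunctor.inclusion hA hN x) =
            F.map (SetFunctor.inclusion hA hN) (Algebra.Initial.strInv hA x)) →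
          ∀ y : N.V, g y = N.str y := by
  obtain ⟨p⟩ := hF
  have hT := behaviourCoalgebraIsTerminal F
  refine ⟨hasInitial_algebra p hT, hT.hasTerminal, fun A hA N hN => ?_⟩
  have hcm : (fun x : A.a => toOmega N (inclusion hA hN x)) = toOmega (invCoalgebra hA) :=
    funext (toOmega_inclusion hA hN)
  have hν := toOmega_injective_of_isTerminal hN
  have hμ : Function.Injective (inclusion hA hN) := by
    refine Function.Injective.of_comp (f := toOmega N) ?_
    change Function.Injective fun x : A.a => toOmega N (inclusion hA hN x)
    exact hcm ▸ toOmega_invCoalgebra_injective hA p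
  refine ⟨hν, hμ, ?_⟩
  let _ : MetricSpace N.V := nuMetric hν
  let _ : MetricSpace A.a := muMetric hA hN hν hμ
  let _ : MetricSpace (F.obj N.V) := mapNuMetric hN hν
  let _ : MetricSpace (F.obj A.a) := mapMuMetric hA hN hν hμ
  have hc : Isometry (toOmega N) := Isometry.of_dist_eq fun _ _ => rfl
  have hm : Isometry (inclusion hA hN) := Isometry.of_dist_eq fun _ _ => rfl
  have hdense : DenseRange (fun x : A.a => toOmega N (inclusion hA hN x)) :=
    hcm ▸ denseRange_toOmega_invCoalgebra p hA
  -- Density in `F^ω 1` restricts to the subspace `νF`, whose topology is induced by `c`.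
  have hmdense : DenseRange (inclusion hA hN) :=
    hc.isEmbedding.isInducing.dense_iff.2 fun y => by
      rw [← Set.range_comp]
      exact hdense _
  -- The metric on `F(νF)` is pulled back along `τ⁻¹`, so `τ` is an isometry.
  have hstr : Continuous N.str := (Isometry.of_dist_eq fun x y => by
    have h := fun x => ConcreteCategory.congr_hom (Coalgebra.Terminal.right_inv hN) x
    exact congrArg₂ dist (h x) (h y)).continuous
  refine ⟨inferInstance, ⟨fun x y z => dist_triangle_max (toOmega N x) _ _⟩,
    ⟨fun x y z => dist_triangle_max (toOmega N (inclusion hA hN x)) _ _⟩,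
    ⟨inferInstance, hc, ?_⟩, ⟨inferInstance, hc.comp hm, hdense⟩, ?_, ?_, hstr,
    str_inclusion hA hN, fun g hg h y => ?_⟩
  · exact hdense.mono (Set.range_comp_subset_range _ _)
  · exact Isometry.of_dist_eq fun x y => congrArg₂ dist (strInv_map_inclusion hA hN x)
      (strInv_map_inclusion hA hN y)
  · refine (Isometry.of_dist_eq fun x y => ?_).continuous
    have h := fun x => ConcreteCategory.congr_hom (Algebra.Initial.left_inv hA) x
    exact congrArg₂ dist (h x) (h y)
  -- Continuous maps into a Hausdorff space that agree on the dense image of `m` are equal.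
  · exact congrFun (hmdense.equalizer hg hstr (funext fun x => (h x).trans
      (str_inclusion hA hN x).symm)) y
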